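/- Let $\Bbbk$ be a field, $n\ge 0$, $L\subseteq\mathbb{Z}^n$ a lattice (i.e. a subgroup, of any rank), and let $I_L=\langle x^u-x^v : u,v\in\mathbb{N}^n,\ u-v\in L\rangle\subseteq \Bbbk[x_1,\dots,x_n]$ be its lattice ideal. A binomial is a difference $x^u-x^v$ of two monomials. A Markov basis of $I_L$ is an inclusion-minimal generating set of $I_L$ consisting of binomials, whose cardinality is the least possible value $\mu(I_L)$ among all such sets. The $I_L$-fiber of a monomial $x^u$ is $F_u=\{x^v : v\in\mathbb{N}^n,\ v-u\in L\}$, and for a nonzero binomial $B=x^u-x^v\in I_L$ put $F_B=F_u$ (this does not depend on how $B$ is written). Two $I_L$-fibers $F,G$ are equivalent, $F\equiv G$, if there are $u,v\in\mathbb{N}^n$ with $x^uF\subseteq G$ and $x^vG\subseteq F$; the equivalence class of $F$ is $\overline F=\{G : G \text{ is an } I_L\text{-fiber},\ G\equiv F\}$. If $S=\{B_1,\dots,B_\mu\}$ and $S'=\{B'_1,\dots,B'_\mu\}$ are Markov bases of $I_L$, where $\mu=\mu(I_L)$, then the multisets $\{\overline{F_{B_1}},\dots,\overline{F_{B_\mu}}\}$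 and $\{\overline{F_{B'_1}},\dots,\overline{F_{B'_\mu}}\}$ are equal. -/

import Mathlib

namespace LatticeIdeal

noncomputable section

/-- The monomial `x^u` of `𝕜[x_1, …, x_n]`. Over a field it determines the exponent vector
`u ∈ ℕ^n`; sets of monomials are represented below by their sets of exponent vectors. -/
abbrev mon (𝕜 : Type*) [Field 𝕜] {n : ℕ} (u : Fin n →₀ ℕ) : MvPolynomial (Fin n) 𝕜 :=
  MvPolynomial.monomial u 1

/-- The difference `u - v ∈ ℤ^n` of two exponent vectors. -/
def diff {n : ℕ} (u v : Fin n →₀ ℕ) : Fin n → ℤ := fun i => (u i : ℤ) - (v i : ℤ)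

/-- The lattice ideal `I_L = ⟨x^u - x^v : u - v ∈ L⟩` of a lattice (subgroup) `L ⊆ ℤ^n`. -/
def latticeIdeal (𝕜 : Type*) [Field 𝕜] {n : ℕ} (L : AddSubgroup (Fin n → ℤ)) :
    Ideal (MvPolynomial (Fin n) 𝕜) :=
  Ideal.span {f | ∃ u v : Fin n →₀ ℕ, diff u v ∈ L ∧ f = mon 𝕜 u - mon 𝕜 v}

/-- Binomials are the differences `x^u - x^v` of two monomials. -/
def IsBinomial {𝕜 : Type*} [Field 𝕜] {n : ℕ} (f : MvPolynomial (Fin n) 𝕜) : Prop :=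
  ∃ u v : Fin n →₀ ℕ, f = mon 𝕜 u - mon 𝕜 v

/-- `S` is a minimal (with respect to inclusion) system of binomial generators of `I`.
As the polynomial ring is Noetherian, such systems are finite. -/
def IsMinimalBinomialGeneratingSet {𝕜 : Type*} [Field 𝕜] {n : ℕ}
    (I : Ideal (MvPolynomial (Fin n) 𝕜)) (S : Finset (MvPolynomial (Fin n) 𝕜)) : Prop :=
  (∀ B ∈ S, IsBinomial B) ∧
    Ideal.span (S : Set (MvPolynomial (Fin n) 𝕜)) = I ∧
    ∀ T : Finset (MvPolynomial (Fin n) 𝕜), T ⊂ S →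
      Ideal.span (T : Set (MvPolynomial (Fin n) 𝕜)) ≠ I

/-- `μ(I)`: the least cardinality of a minimal system of binomial generators of `I`. -/
def mu {𝕜 : Type*} [Field 𝕜] {n : ℕ} (I : Ideal (MvPolynomial (Fin n) 𝕜)) : ℕ :=
  sInf {c | ∃ S : Finset (MvPolynomial (Fin n) 𝕜),
    IsMinimalBinomialGeneratingSet I S ∧ S.card = c}

/-- A Markov basis of `I`: a minimal system of binomial generators of cardinality `μ(I)`. -/
def IsMarkovBasis {𝕜 : Type*} [Field 𝕜] {n : ℕ}
    (I : Ideal (MvPolynomial (Fin n) 𝕜)) (S : Finset (MvPolynomial (Fin n) 𝕜)) : Prop :=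
  IsMinimalBinomialGeneratingSet I S ∧ S.card = mu I

/-- The fiber `F_u = {x^v : v - u ∈ L}`. -/
def fiber {n : ℕ} (L : AddSubgroup (Fin n → ℤ)) (u : Fin n →₀ ℕ) : Set (Fin n →₀ ℕ) :=
  {v | diff v u ∈ L}

/-- `F` is an `I_L`-fiber. -/
def IsFiber {n : ℕ} (L : AddSubgroup (Fin n → ℤ)) (F : Set (Fin n →₀ ℕ)) : Prop :=
  ∃ u, F = fiber L u

/-- The relation `F ≡ G`: there are `u, v ∈ ℕ^n` with `x^u F ⊆ G` and `x^v G ⊆ F`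
(multiplying monomials adds exponent vectors). -/
def FiberEquiv {n : ℕ} (F G : Set (Fin n →₀ ℕ)) : Prop :=
  ∃ u v : Fin n →₀ ℕ, (∀ w ∈ F, u + w ∈ G) ∧ (∀ w ∈ G, v + w ∈ F)

/-- The equivalence class `{G : G is an I_L-fiber, G ≡ F}` of a fiber `F`. -/
def fiberClass {n : ℕ} (L : AddSubgroup (Fin n → ℤ)) (F : Set (Fin n →₀ ℕ)) :
    Set (Set (Fin n →₀ ℕ)) :=
  {G | IsFiber L G ∧ FiberEquiv G F}

/-- The fiber `F_B` of a binomial `B ∈ I_L`: it is `F_u` if `0 ≠ B = x^u - x^v ∈ I_L`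
(`binomialFiber_eq` below). -/
def binomialFiber {𝕜 : Type*} [Field 𝕜] {n : ℕ} (L : AddSubgroup (Fin n → ℤ))
    (B : MvPolynomial (Fin n) 𝕜) : Set (Fin n →₀ ℕ) :=
  {w | ∃ u v : Fin n →₀ ℕ, B = mon 𝕜 u - mon 𝕜 v ∧ w ∈ fiber L u}

/-- The multiset of the classes of the fibers `F_B`, for `B` in a finite set `S` of binomials. -/
def fiberClassMultiset {𝕜 : Type*} [Field 𝕜] {n : ℕ} (L : AddSubgroup (Fin n → ℤ))
    (S : Finset (MvPolynomial (Fin n) 𝕜)) : Multiset (Set (Set (Fin n →₀ ℕ))) :=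
  S.val.map fun B => fiberClass L (binomialFiber L B)

/-- If `x^u - x^v ∈ I_L` then `u - v ∈ L`. -/
theorem diff_mem_of_sub_mem {𝕜 : Type*} [Field 𝕜] {n : ℕ} {L : AddSubgroup (Fin n → ℤ)}
    {u v : Fin n →₀ ℕ} (h : mon 𝕜 u - mon 𝕜 v ∈ latticeIdeal 𝕜 L) : diff u v ∈ L := by
  classical
  let d : (Fin n →₀ ℕ) →+ ((Fin n → ℤ) ⧸ L) :=
    { toFun := fun w => QuotientAddGroup.mk (fun i => (w i : ℤ))
      map_zero' := by
        refine (QuotientAddGroup.eq_zero_iff _).2 ?_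
        convert L.zero_mem using 1
        ext i; simp
      map_add' := fun a b => by
        rw [← QuotientAddGroup.mk_add]
        congr 1 }
  let φ : MvPolynomial (Fin n) 𝕜 →+* AddMonoidAlgebra 𝕜 ((Fin n → ℤ) ⧸ L) :=
    AddMonoidAlgebra.mapDomainRingHom 𝕜 d
  have hφ : ∀ w, φ (mon 𝕜 w) = AddMonoidAlgebra.single (d w) 1 := fun w => by
    exact AddMonoidAlgebra.mapDomain_single
  have hd : ∀ a b, d a = d b ↔ diff a b ∈ L := fun a b => by
    rw [← sub_eq_zero]
    change (QuotientAddGroup.mk _ - QuotientAddGroup.mk _ : (Fin n → ℤ) ⧸ L) = 0 ↔ _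
    rw [← QuotientAddGroup.mk_sub, QuotientAddGroup.eq_zero_iff]
    rfl
  have hker : latticeIdeal 𝕜 L ≤ RingHom.ker φ := by
    refine Ideal.span_le.2 ?_
    rintro f ⟨a, b, hab, rfl⟩
    simp only [SetLike.mem_coe, RingHom.mem_ker, map_sub, hφ, (hd a b).2 hab, sub_self]
  have h0 := hker h
  rw [RingHom.mem_ker, map_sub, hφ, hφ, sub_eq_zero] at h0
  refine (hd u v).1 ?_
  exact AddMonoidAlgebra.single_left_injective one_ne_zero h0

/-- The fiber of a nonzero binomial of `I_L` does not depend on how the binomial is written. -/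
theorem binomialFiber_eq {𝕜 : Type*} [Field 𝕜] {n : ℕ} {L : AddSubgroup (Fin n → ℤ)}
    {u v : Fin n →₀ ℕ} (huv : u ≠ v) (h : mon 𝕜 u - mon 𝕜 v ∈ latticeIdeal 𝕜 L) :
    binomialFiber L (mon 𝕜 u - mon 𝕜 v) = fiber L u := by
  classical
  have hL := diff_mem_of_sub_mem h
  ext w
  constructor
  · rintro ⟨a, b, hab, hw⟩
    have hc := congrArg (MvPolynomial.coeff u) hab
    simp only [MvPolynomial.coeff_sub, MvPolynomial.coeff_monomial, if_true,
      if_neg (Ne.symm huv)] at hc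
    by_cases ha : a = u
    · exact ha ▸ hw
    · have hb : b = u := by
        by_contra hb
        simp [ha, hb] at hc
      have hc' := congrArg (MvPolynomial.coeff v) hab
      subst hb
      have hav : a = v := by
        by_contra hav
        simp [huv, hav] at hc'
      subst hav
      have h2 := L.sub_mem hw hL
      have e : diff w b = diff w a - diff b a := by
        ext i; simp [diff]
      exact show diff w b ∈ L from e ▸ h2
  · intro hw
    exact ⟨u, v, rfl, hw⟩

end

end LatticeIdeal

namespace LatticeIdeal

open MvPolynomial

/-! Fix an equivalence class `c`. If the members of `S` in class `c` are replaced by the members of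
`S'` in class `c`, the result still generates `I_L` (`span_exchange`). It therefore has at least
`μ(I_L) = |S|` elements, so `S` has at most as many members in class `c` as `S'`; symmetry gives
equality of multiplicities.

The exchange rests on the grading by `ℤ^n / L`, whose homogeneous monomials of one degree form a
fiber: a binomial needs only generators whose fibers divide its own (`mem_span_fiberDvd`).
Divisibility of fibers is merely a preorder, with `≡` as its symmetric part. No positivity of the
grading and no induction on fibers is used. -/

/-- `F` divides `G` if `x^u F ⊆ G` for some `u`. -/
def FiberDvd {n : ℕ} (F G : Set (Fin n →₀ ℕ)) : Prop :=
  ∃ u : Fin n →₀ ℕ, ∀ w ∈ F, u + w ∈ G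

theorem FiberDvd.refl {n : ℕ} (F : Set (Fin n →₀ ℕ)) : FiberDvd F F :=
  ⟨0, fun w hw => by simpa using hw⟩

theorem FiberDvd.trans {n : ℕ} {F G H : Set (Fin n →₀ ℕ)} (h₁ : FiberDvd F G)
    (h₂ : FiberDvd G H) : FiberDvd F H := by
  obtain ⟨u, hu⟩ := h₁
  obtain ⟨v, hv⟩ := h₂
  exact ⟨v + u, fun w hw => by simpa [add_assoc] using hv _ (hu w hw)⟩

theorem fiberEquiv_iff {n : ℕ} {F G : Set (Fin n →₀ ℕ)} :
    FiberEquiv F G ↔ FiberDvd F G ∧ FiberDvd G F :=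
  ⟨fun ⟨u, v, hu, hv⟩ => ⟨⟨u, hu⟩, v, hv⟩, fun ⟨⟨u, hu⟩, v, hv⟩ => ⟨u, v, hu, hv⟩⟩

theorem fiberClass_eq_iff {n : ℕ} {L : AddSubgroup (Fin n → ℤ)} {F G : Set (Fin n →₀ ℕ)}
    (hF : IsFiber L F) : fiberClass L F = fiberClass L G ↔ FiberDvd F G ∧ FiberDvd G F := by
  constructor
  · intro h
    have : F ∈ fiberClass L G :=
      h ▸ ⟨hF, fiberEquiv_iff.2 ⟨FiberDvd.refl F, FiberDvd.refl F⟩⟩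
    exact fiberEquiv_iff.1 this.2
  · rintro ⟨h₁, h₂⟩
    ext H
    simp only [fiberClass, Set.mem_ofPred_eq, fiberEquiv_iff]
    exact ⟨fun ⟨a, b, c⟩ => ⟨a, b.trans h₁, h₂.trans c⟩,
      fun ⟨a, b, c⟩ => ⟨a, b.trans h₂, h₁.trans c⟩⟩

/-- The degrees of the variables for the grading of the polynomial ring by `ℤ^n / L`. -/
def varDegree {n : ℕ} (L : AddSubgroup (Fin n → ℤ)) (i : Fin n) : (Fin n → ℤ) ⧸ L :=
  QuotientAddGroup.mk (Pi.single i 1)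

theorem weight_varDegree {n : ℕ} (L : AddSubgroup (Fin n → ℤ)) (u : Fin n →₀ ℕ) :
    Finsupp.weight (varDegree L) u = QuotientAddGroup.mk (fun i => (u i : ℤ)) := by
  rw [Finsupp.weight_apply, Finsupp.sum_fintype _ _ (by simp)]
  have : (fun i => (u i : ℤ)) = ∑ i, u i • (Pi.single i 1 : Fin n → ℤ) := by
    ext j
    simp [Finset.sum_apply, Pi.single_apply]
  rw [this, ← QuotientAddGroup.mk'_apply, map_sum]
  simp [varDegree]

theorem weight_eq_iff {n : ℕ} {L : AddSubgroup (Fin n → ℤ)} {u v : Fin n →₀ ℕ} :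
    Finsupp.weight (varDegree L) u = Finsupp.weight (varDegree L) v ↔ diff u v ∈ L := by
  rw [weight_varDegree, weight_varDegree, ← sub_eq_zero, ← QuotientAddGroup.mk_sub,
    QuotientAddGroup.eq_zero_iff]
  rfl

theorem mem_fiber_iff {n : ℕ} {L : AddSubgroup (Fin n → ℤ)} {u v : Fin n →₀ ℕ} :
    v ∈ fiber L u ↔ Finsupp.weight (varDegree L) v = Finsupp.weight (varDegree L) u :=
  weight_eq_iff.symm

/-- A fiber consists of all monomials of one degree, so divisibility can be tested on a single
representative. -/
theorem fiberDvd_fiber {n : ℕ} {L : AddSubgroup (Fin n → ℤ)} {u v w : Fin n →₀ ℕ}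
    (h : Finsupp.weight (varDegree L) (w + u) = Finsupp.weight (varDegree L) v) :
    FiberDvd (fiber L u) (fiber L v) := by
  refine ⟨w, fun x hx => ?_⟩
  rw [mem_fiber_iff] at hx ⊢
  rw [← h, map_add, map_add, hx]

section Generators

variable {𝕜 : Type*} [Field 𝕜] {n : ℕ} {L : AddSubgroup (Fin n → ℤ)}

theorem IsBinomial.exists_fiber_eq {B : MvPolynomial (Fin n) 𝕜} (hB : IsBinomial B)
    (h0 : B ≠ 0) (hI : B ∈ latticeIdeal 𝕜 L) :
    ∃ u v : Fin n →₀ ℕ, B = mon 𝕜 u - mon 𝕜 v ∧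
      Finsupp.weight (varDegree L) v = Finsupp.weight (varDegree L) u ∧
      binomialFiber L B = fiber L u := by
  obtain ⟨u, v, rfl⟩ := hB
  have huv : u ≠ v := by
    rintro rfl
    exact h0 (sub_self _)
  exact ⟨u, v, rfl, (weight_eq_iff.2 (diff_mem_of_sub_mem hI)).symm, binomialFiber_eq huv hI⟩

theorem isWeightedHomogeneous_binomial {u v : Fin n →₀ ℕ} {a : (Fin n → ℤ) ⧸ L}
    (hu : Finsupp.weight (varDegree L) u = a) (hv : Finsupp.weight (varDegree L) v = a) :
    IsWeightedHomogeneous (varDegree L) (mon 𝕜 u - mon 𝕜 v) a :=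
  (weightedHomogeneousSubmodule 𝕜 (varDegree L) a).sub_mem
    (isWeightedHomogeneous_monomial _ _ _ hu) (isWeightedHomogeneous_monomial _ _ _ hv)

/-- A binomial of a lattice ideal is generated by the generators whose fibers divide its fiber. -/
theorem mem_span_fiberDvd {S : Set (MvPolynomial (Fin n) 𝕜)}
    (hbin : ∀ B ∈ S, IsBinomial B) (h0 : ∀ B ∈ S, B ≠ 0)
    (hspan : Ideal.span S = latticeIdeal 𝕜 L) {B₀ : MvPolynomial (Fin n) 𝕜}
    (hB₀ : IsBinomial B₀) (hB₀0 : B₀ ≠ 0) (hB₀I : B₀ ∈ latticeIdeal 𝕜 L) :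
    B₀ ∈ Ideal.span {B ∈ S | FiberDvd (binomialFiber L B) (binomialFiber L B₀)} := by
  classical
  obtain ⟨u₀, v₀, rfl, hv₀, hF₀⟩ := hB₀.exists_fiber_eq hB₀0 hB₀I
  rw [hF₀]
  set J := Ideal.span {B ∈ S | FiberDvd (binomialFiber L B) (fiber L u₀)} with hJ
  set π := weightedHomogeneousComponent (R := 𝕜) (varDegree L)
    (Finsupp.weight (varDegree L) u₀) with hπ
  -- The factor `r` is built into the claim so that the induction over the span passes through
  -- scalar multiples.
  have key : ∀ f ∈ Ideal.span S, ∀ r, π (r * f) ∈ J := by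
    intro f hf
    induction hf using Submodule.span_induction with
    | mem B hB =>
      intro r
      have hBI : B ∈ latticeIdeal 𝕜 L := hspan ▸ Ideal.subset_span hB
      obtain ⟨u, v, hBe, hv, hF⟩ := (hbin B hB).exists_fiber_eq (h0 B hB) hBI
      have hBh : IsWeightedHomogeneous (varDegree L) B (Finsupp.weight (varDegree L) u) :=
        hBe ▸ isWeightedHomogeneous_binomial rfl hv
      induction r using MvPolynomial.induction_on' with
      | monomial w c =>
        have hw := (isWeightedHomogeneous_monomial (varDegree L) w c rfl).mul hBh
        by_cases hdeg : Finsupp.weight (varDegree L) (w + u) = Finsupp.weight (varDegree L) u₀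
        · rw [← map_add, hdeg] at hw
          rw [hπ, weightedHomogeneousComponent_of_mem hw, if_pos rfl]
          -- A term survives `π` only in the degree of `u₀`, and then `x^w` itself carries the fiber
          -- of `B` into that of `u₀`.
          exact J.mul_mem_left _ (Ideal.subset_span ⟨hB, hF ▸ fiberDvd_fiber hdeg⟩)
        · rw [← map_add] at hw
          rw [hπ, weightedHomogeneousComponent_of_mem hw, if_neg (Ne.symm hdeg)]
          exact J.zero_mem
      | add p q hp hq =>
        rw [add_mul, map_add]
        exact J.add_mem hp hq
    | zero => simp
    | add f g _ _ hf hg =>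
      intro r
      rw [mul_add, map_add]
      exact J.add_mem (hf r) (hg r)
    | smul s f _ hf =>
      intro r
      rw [smul_eq_mul, ← mul_assoc]
      exact hf (r * s)
  have h := key _ (hspan ▸ hB₀I) 1
  rwa [one_mul, hπ, weightedHomogeneousComponent_of_mem
    (isWeightedHomogeneous_binomial rfl hv₀), if_pos rfl] at h

/-- Dropping `0` never changes a span. Zero has to be excluded because `binomialFiber L 0` contains
every monomial and need not be a fiber. -/
theorem IsMinimalBinomialGeneratingSet.ne_zero {I : Ideal (MvPolynomial (Fin n) 𝕜)}
    {S : Finset (MvPolynomial (Fin n) 𝕜)} (hS : IsMinimalBinomialGeneratingSet I S) :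
    ∀ B ∈ S, B ≠ 0 := by
  classical
  rintro B hB rfl
  refine hS.2.2 _ (Finset.erase_ssubset hB) ?_
  rw [← hS.2.1, Finset.coe_erase]
  exact Submodule.span_sdiff_singleton_zero

/-- `mu` ranges over inclusion-minimal sets only, so the given set is first shrunk to a minimal one.
-/
theorem mu_le_card {I : Ideal (MvPolynomial (Fin n) 𝕜)} {S : Finset (MvPolynomial (Fin n) 𝕜)}
    (hbin : ∀ B ∈ S, IsBinomial B) (hspan : Ideal.span (S : Set _) = I) : mu I ≤ S.card := by
  obtain ⟨T, hTS, hT⟩ := exists_minimal_le_of_wellFoundedLT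
    (fun T : Finset (MvPolynomial (Fin n) 𝕜) =>
      (∀ B ∈ T, IsBinomial B) ∧ Ideal.span (T : Set _) = I) S ⟨hbin, hspan⟩
  have hmin : IsMinimalBinomialGeneratingSet I T := ⟨hT.prop.1, hT.prop.2, fun U hU hUI =>
    hT.not_prop_of_lt hU ⟨fun B hB => hT.prop.1 B (hU.1 hB), hUI⟩⟩
  have hle : mu I ≤ T.card := Nat.sInf_le ⟨T, hmin, rfl⟩
  exact hle.trans (Finset.card_le_card hTS)

open Classical in
/-- Exchanging the generators in one class for those of another generating set. -/
theorem span_exchange {S S' : Finset (MvPolynomial (Fin n) 𝕜)}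
    (hS : IsMinimalBinomialGeneratingSet (latticeIdeal 𝕜 L) S)
    (hS' : IsMinimalBinomialGeneratingSet (latticeIdeal 𝕜 L) S')
    (c : Set (Set (Fin n →₀ ℕ))) :
    Ideal.span ((S.filter (fun B => ¬ fiberClass L (binomialFiber L B) = c) ∪
      S'.filter (fun B => fiberClass L (binomialFiber L B) = c) : Finset _) :
        Set (MvPolynomial (Fin n) 𝕜)) = latticeIdeal 𝕜 L := by
  have hSI : ∀ B ∈ S, B ∈ latticeIdeal 𝕜 L := fun B hB => hS.2.1 ▸ Ideal.subset_span hB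
  have hSI' : ∀ B ∈ S', B ∈ latticeIdeal 𝕜 L := fun B hB => hS'.2.1 ▸ Ideal.subset_span hB
  have isFiber : ∀ B, IsBinomial B → B ≠ 0 → B ∈ latticeIdeal 𝕜 L →
      IsFiber L (binomialFiber L B) := fun B h₁ h₂ h₃ => by
    obtain ⟨u, -, -, -, h⟩ := h₁.exists_fiber_eq h₂ h₃
    exact ⟨u, h⟩
  apply le_antisymm
  · refine Ideal.span_le.2 fun B hB => ?_
    simp only [Finset.coe_union, Finset.coe_filter, Set.mem_union, Set.mem_ofPred_eq] at hB
    rcases hB with hB | hB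
    exacts [hSI B hB.1, hSI' B hB.1]
  rw [← hS.2.1]
  refine Ideal.span_le.2 fun B hB => ?_
  by_cases hc : fiberClass L (binomialFiber L B) = c
  swap
  · exact Ideal.subset_span (by simp [hc, Finset.mem_coe.1 hB])
  -- A removed `B` is rewritten through `S'`; any `B'` used there that lies outside class `c` is
  -- rewritten back through `S`.
  refine Ideal.span_le.2 ?_ (mem_span_fiberDvd hS'.1 hS'.ne_zero hS'.2.1
    (hS.1 B hB) (hS.ne_zero B hB) (hSI B hB))
  rintro B' ⟨hB', hdvd'⟩
  by_cases hc' : fiberClass L (binomialFiber L B') = c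
  · exact Ideal.subset_span (by simp [hc', Finset.mem_coe.1 hB'])
  refine Ideal.span_mono ?_ (mem_span_fiberDvd hS.1 hS.ne_zero hS.2.1
    (hS'.1 B' hB') (hS'.ne_zero B' hB') (hSI' B' hB'))
  rintro B'' ⟨hB'', hdvd''⟩
  -- If `B''` were in class `c`, then `F_B` would divide `F_{B''}`, which divides `F_{B'}`, which
  -- divides `F_B`. This would force `B'` into class `c`.
  have hc'' : fiberClass L (binomialFiber L B'') ≠ c := by
    intro h
    have hF := isFiber B'' (hS.1 B'' hB'') (hS.ne_zero B'' hB'') (hSI B'' hB'')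
    have hd := ((fiberClass_eq_iff hF).1 (h.trans hc.symm)).2
    refine hc' (Eq.trans ?_ hc)
    exact (fiberClass_eq_iff (isFiber B' (hS'.1 B' hB') (hS'.ne_zero B' hB') (hSI' B' hB'))).2
      ⟨hdvd', hd.trans hdvd''⟩
  simp [hc'', Finset.mem_coe.1 hB'']

open Classical in
theorem IsMarkovBasis.card_filter_le {S S' : Finset (MvPolynomial (Fin n) 𝕜)}
    (hS : IsMarkovBasis (latticeIdeal 𝕜 L) S) (hS' : IsMarkovBasis (latticeIdeal 𝕜 L) S')
    (c : Set (Set (Fin n →₀ ℕ))) :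
    (S.filter (fun B => fiberClass L (binomialFiber L B) = c)).card ≤
      (S'.filter (fun B => fiberClass L (binomialFiber L B) = c)).card := by
  have hle := mu_le_card (fun B hB => ?_) (span_exchange hS.1 hS'.1 c)
  -- The two pieces of the exchanged set need not be known disjoint: the upper bound on the size of
  -- their union suffices.
  · have hunion := hle.trans (Finset.card_union_le _ _)
    have hsplit := S.card_filter_add_card_filter_not
      (fun B => fiberClass L (binomialFiber L B) = c)
    have hcard := hS.2
    omega
  · rcases Finset.mem_union.1 hB with hB | hB
    exacts [hS.1.1 B (Finset.mem_filter.1 hB).1, hS'.1.1 B (Finset.mem_filter.1 hB).1]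

open Classical in
theorem count_fiberClassMultiset (S : Finset (MvPolynomial (Fin n) 𝕜))
    (c : Set (Set (Fin n →₀ ℕ))) :
    (fiberClassMultiset L S).count c =
      (S.filter (fun B => fiberClass L (binomialFiber L B) = c)).card := by
  rw [fiberClassMultiset, Multiset.count_map, Finset.card_def, Finset.filter_val]
  simp only [eq_comm]

end Generators

end LatticeIdeal

theorem corollary4p11 (𝕜 : Type*) [Field 𝕜] (n : ℕ) (L : AddSubgroup (Fin n → ℤ))
    (S S' : Finset (MvPolynomial (Fin n) 𝕜))
    (hS : LatticeIdeal.IsMarkovBasis (LatticeIdeal.latticeIdeal 𝕜 L) S)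
    (hS' : LatticeIdeal.IsMarkovBasis (LatticeIdeal.latticeIdeal 𝕜 L) S') :
    LatticeIdeal.fiberClassMultiset L S = LatticeIdeal.fiberClassMultiset L S' := by
  classical
  ext c
  convert le_antisymm (hS.card_filter_le hS' c) (hS'.card_filter_le hS c) using 1
  · convert LatticeIdeal.count_fiberClassMultiset S c
  · convert LatticeIdeal.count_fiberClassMultiset S' c
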